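/- Let $G$ be a finite simple graph on the vertex set $[n]=\{1,\dots,n\}$ and let $K$ be a field. For $P\subset\mathbb R^n$ with $P\cap\mathbb Z^n$ finite, let $I_P$ be the toric ideal of $P$, i.e. the kernel of the $K$-algebra homomorphism $K[x_{\mathbf a}:\mathbf a\in P\cap\mathbb Z^n]\to K[t_1^{\pm1},\dots,t_n^{\pm1},s]$ with $x_{\mathbf a}\mapsto \mathbf t^{\mathbf a}s$. A quadratic binomial is a difference $u-v$ of two distinct monomials of degree $2$; an ideal is generated by quadratic binomials if it is generated by some (possibly empty) set of them. A set $S\subset[n]$ is stable if no two of its elements are adjacent in $G$. The stable set polytope $\mathcal P_G\subset\mathbb R^n$ is the convex hull of the vectors $\sum_{j\in S}\mathbf e_j$ over all stable sets $S$ (including $\emptyset$), and $\mathcal P_G^{\pm}=\{(\varepsilon_1x_1,\dots,\varepsilon_nx_n):\varepsilon\in\{-1,1\}^n,\ \mathbf x\in\mathcal P_G\}$. The ideal $I_G:=I_{\mathcal P_G}$ is the stable set ideal and $I_{G^\pm}:=I_{\mathcal P_G^\pm}$ is the symmetric stable set ideal of $G$. For $\mathbf a=(a_1,\dots,a_n)\in\mathbb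 Z_{\ge0}^n$, let $G_{\mathbf a}$ be the graph obtained from $G$ by replacing each vertex $i$ with a complete graph $G^{(i)}$ on $a_i$ vertices (deleting $i$ if $a_i=0$) and joining every vertex of $G^{(i)}$ to every vertex of $G^{(j)}$ whenever $\{i,j\}$ is an edge of $G$. A $k$-coloring of a graph is a map from its vertices to $[k]$ taking different values on adjacent vertices, and $\chi$ denotes the chromatic number, the least $k$ for which a $k$-coloring exists. A Kempe switching of a $k$-coloring $f$ exchanges two colors $i<j$ on one connected component of the subgraph induced on $f^{-1}(i)\cup f^{-1}(j)$, leaving all other colors unchanged; two $k$-colorings are Kempe equivalent if one is obtained from the other by a finite (possibly empty) sequence of Kempe switchings. Then the following conditions are equivalent: (i) $I_{G^{\pm}}$ is generated by quadratic binomials; (ii) $I_G$ is generated by quadratic binomials; (iii) for every $\mathbf a\in\mathbb Z_{\ge0}^n$ and every integer $k\ge\chi(G_{\mathbf a})$, all $k$-colorings of $G_{\mathbf a}$ are Kempe equivalent. -/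

import Mathlib

namespace StableToric

/-! ### Lattice polytopes, toric rings and toric ideals -/

/-- The lattice points of a subset `P` of `ℝⁿ`. -/
def latticePoints {n : ℕ} (P : Set (Fin n → ℝ)) : Set (Fin n → ℤ) :=
  {a | (fun i => (a i : ℝ)) ∈ P}

/-- The set `P^± = {ε x : ε ∈ {-1, 1}ⁿ, x ∈ P}`, where `ε x` is the coordinatewise product. -/
def symmetrize {n : ℕ} (P : Set (Fin n → ℝ)) : Set (Fin n → ℝ) :=
  {y | ∃ ε : Fin n → ℝ, (∀ i, ε i = 1 ∨ ε i = -1) ∧ ∃ x ∈ P, y = fun i => ε i * x i}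

/-- The ring `K[t₁^±¹, …, tₙ^±¹, s]`: its monomials `t^a s^d` are indexed by the
pairs `(a, d)` in `ℤⁿ × ℕ`. -/
abbrev LaurentRing (K : Type*) [Field K] (n : ℕ) : Type _ :=
  AddMonoidAlgebra K ((Fin n → ℤ) × ℕ)

/-- The monomial `t^a s`. -/
noncomputable def toricMonomial (K : Type*) [Field K] {n : ℕ} (a : Fin n → ℤ) :
    LaurentRing K n :=
  AddMonoidAlgebra.single (a, 1) 1

/-- The toric ring `K[P]`: the subalgebra generated by the monomials `t^a s`, where `a` runs
over the lattice points of `P`. -/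
noncomputable def toricRing (K : Type*) [Field K] {n : ℕ} (P : Set (Fin n → ℝ)) :
    Subalgebra K (LaurentRing K n) :=
  Algebra.adjoin K (toricMonomial K '' latticePoints P)

/-- The homomorphism from the polynomial ring with one variable `x_a` for each lattice point
`a` of `P` to the toric ring, sending `x_a` to `t^a s`. -/
noncomputable def toricMap (K : Type*) [Field K] {n : ℕ} (P : Set (Fin n → ℝ)) :
    MvPolynomial (latticePoints P) K →ₐ[K] toricRing K P :=
  MvPolynomial.aeval fun a =>
    ⟨toricMonomial K a.1, Algebra.subset_adjoin (Set.mem_image_of_mem _ a.2)⟩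

/-- The toric ideal `I_P`. -/
noncomputable def toricIdeal (K : Type*) [Field K] {n : ℕ} (P : Set (Fin n → ℝ)) :
    Ideal (MvPolynomial (latticePoints P) K) :=
  RingHom.ker (toricMap K P)

/-- A quadratic binomial: a difference of two distinct monomials of degree two. -/
def IsQuadraticBinomial {σ K : Type*} [Field K] (p : MvPolynomial σ K) : Prop :=
  ∃ u v : σ →₀ ℕ, u.degree = 2 ∧ v.degree = 2 ∧ u ≠ v ∧
    p = MvPolynomial.monomial u 1 - MvPolynomial.monomial v 1

/-- The ideal is generated by quadratic binomials (the zero ideal is, by the empty set). -/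
def GeneratedByQuadraticBinomials {σ K : Type*} [Field K] (I : Ideal (MvPolynomial σ K)) :
    Prop :=
  ∃ F : Set (MvPolynomial σ K), (∀ p ∈ F, IsQuadraticBinomial p) ∧ Ideal.span F = I

/-! ### Stable set polytopes -/

/-- The stable set polytope: the convex hull of the indicator vectors of the stable sets. -/
def stableSetPolytope {n : ℕ} (G : SimpleGraph (Fin n)) : Set (Fin n → ℝ) :=
  convexHull ℝ {v | ∃ S : Set (Fin n), G.IsIndepSet S ∧ v = S.indicator (fun _ => (1 : ℝ))}

/-- The stable set ideal `I_G`. -/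
noncomputable def stableSetIdeal (K : Type*) [Field K] {n : ℕ} (G : SimpleGraph (Fin n)) :
    Ideal (MvPolynomial (latticePoints (stableSetPolytope G)) K) :=
  toricIdeal K (stableSetPolytope G)

/-- The symmetric stable set ideal `I_{G^±}`. -/
noncomputable def symmetricStableSetIdeal (K : Type*) [Field K] {n : ℕ}
    (G : SimpleGraph (Fin n)) :
    Ideal (MvPolynomial (latticePoints (symmetrize (stableSetPolytope G))) K) :=
  toricIdeal K (symmetrize (stableSetPolytope G))

/-! ### Replication graphs and Kempe equivalence -/

/-- The graph `G_a`: each vertex `i` is replaced by a complete graph on `a i` vertices, and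
all copies of `i` are joined to all copies of `j` whenever `i` and `j` are adjacent. -/
def replicationGraph {n : ℕ} (G : SimpleGraph (Fin n)) (a : Fin n → ℕ) :
    SimpleGraph (Σ i : Fin n, Fin (a i)) where
  Adj x y := (x.1 = y.1 ∧ x ≠ y) ∨ G.Adj x.1 y.1
  symm := ⟨fun _ _ h => h.imp (fun h => ⟨h.1.symm, h.2.symm⟩) (fun h => h.symm)⟩
  loopless := ⟨fun x h => h.elim (fun h => h.2 rfl) (fun h => G.loopless.irrefl _ h)⟩

/-- The coloring `g` is obtained from `f` by a Kempe switching: for some colors `i < j`, the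
two colors are exchanged on one connected component `H` of the subgraph induced on
`f⁻¹(i) ∪ f⁻¹(j)`, and all other vertices keep their color. -/
def KempeSwitch {V : Type*} {G : SimpleGraph V} {k : ℕ} (f g : G.Coloring (Fin k)) : Prop :=
  ∃ i j : Fin k, i < j ∧ ∃ H : (G.induce {v | f v = i ∨ f v = j}).ConnectedComponent,
    (∀ x, x ∉ Subtype.val '' H.supp → g x = f x) ∧
    (∀ x, x ∈ Subtype.val '' H.supp → f x = j → g x = i) ∧
    (∀ x, x ∈ Subtype.val '' H.supp → f x = i → g x = j)

/-- Two colorings are Kempe equivalent if a finite (possibly empty) sequence of Kempe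
switchings leads from one to the other. -/
def KempeEquivalent {V : Type*} {G : SimpleGraph V} {k : ℕ} (f g : G.Coloring (Fin k)) :
    Prop :=
  Relation.ReflTransGen KempeSwitch f g

end StableToric

/-!
All three conditions say that families of indicator vectors of stable sets are connected under
exchange moves. A monomial of degree `k` in the variables `x_a` is an unordered family of `k` lattice
points, and its image under the toric map records the size and the sum of the family. An exchange
move (`ExchangeStep`) replaces two entries of a family by two lattice points with the same sum;
permuting the entries is a composition of such moves.

*Ideals.* The kernel of a monomial homomorphism is spanned by binomials, so it is generated by
quadratic binomials exactly when any two monomials with the same image are joined by replacing factors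
of degree two (`generatedByQuadraticBinomials_ker_iff`). For a toric ideal this is
`ExchangeConnected` for the lattice points (`generatedByQuadraticBinomials_toricIdeal_iff`). The
lattice points of `P_G` and `P_G^±` are the vectors with entries in `{0, 1}`, respectively
`{-1, 0, 1}`, whose support is stable.

*Signs.* A family of signed vectors is joined to one without cancelling pairs `1`, `-1` in the same
coordinate; the signs in such a family are those of its sum and can be removed. Hence connectedness for
stable vectors implies connectedness for signed ones (`exchangeConnected_signedStableVectors`).
Conversely, a path of signed families between two unsigned ones may leave the nonnegative orthant. Each
signed family on it dominates unsigned families with the same sum, obtained by forgetting the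
entries `-1` and some of the entries `1`. All choices are joined to each other by moving single
entries (`Dominated.reflTransGen_exchangeStep`), and a signed move lifts for a suitable choice
(`ExchangeStep.exists_dominated`).

*Colorings.* The color classes of a `k`-coloring of `G_a` project to a family of `k` stable sets of
`G` with sum `a`, and every such family arises. A Kempe switching is an exchange move. Conversely, an
exchange move recolors vertices within two colors only, and two colorings that differ within two
colors are Kempe equivalent, because on each component of the two-colored subgraph they agree or are
exchanged (`kempeEquivalent_of_two_colors`). The same fact handles colorings with equal families, which
differ by permutations inside the cliques of `G_a`.
-/

namespace StableToric

/-! ### Exchange moves on families of lattice vectors -/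

/-- An exchange move between two families of vectors of `L`: two of the entries are replaced by two
vectors of `L` with the same sum. Transposing two entries is a special case. -/
def ExchangeStep {n k : ℕ} (L : Set (Fin n → ℤ)) (s t : Fin k → Fin n → ℤ) : Prop :=
  (∀ c, s c ∈ L) ∧ (∀ c, t c ∈ L) ∧
    ∃ p q, p ≠ q ∧ s p + s q = t p + t q ∧ ∀ c, c ≠ p → c ≠ q → s c = t c

/-- Any two families of vectors of `L` with the same size and the same sum are joined by
exchange moves. -/
def ExchangeConnected {n : ℕ} (L : Set (Fin n → ℤ)) : Prop :=
  ∀ (k : ℕ) (s t : Fin k → Fin n → ℤ), (∀ c, s c ∈ L) → (∀ c, t c ∈ L) →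
    ∑ c, s c = ∑ c, t c → Relation.ReflTransGen (ExchangeStep L) s t

theorem sum_eq_add_add_sum_erase {ι M : Type*} [Fintype ι] [DecidableEq ι] [AddCommMonoid M]
    (f : ι → M) {p q : ι} (h : p ≠ q) :
    ∑ c, f c = (f p + f q) + ∑ c ∈ (Finset.univ.erase p).erase q, f c := by
  rw [← Finset.add_sum_erase _ f (Finset.mem_univ p),
    ← Finset.add_sum_erase _ f (Finset.mem_erase.2 ⟨h.symm, Finset.mem_univ q⟩), add_assoc]

theorem sum_eq_sum_iff_of_eq_off_pair {ι M : Type*} [Fintype ι] [DecidableEq ι]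
    [AddCancelCommMonoid M] {f g : ι → M} {p q : ι} (h : p ≠ q)
    (hfg : ∀ c, c ≠ p → c ≠ q → f c = g c) :
    ∑ c, f c = ∑ c, g c ↔ f p + f q = g p + g q := by
  rw [sum_eq_add_add_sum_erase f h, sum_eq_add_add_sum_erase g h,
    Finset.sum_congr rfl fun c hc => hfg c ?_ ?_, add_left_inj]
  · exact (Finset.mem_erase.1 (Finset.mem_erase.1 hc).2).1
  · exact (Finset.mem_erase.1 hc).1

theorem ExchangeStep.symm {n k : ℕ} {L : Set (Fin n → ℤ)} {s t : Fin k → Fin n → ℤ}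
    (h : ExchangeStep L s t) : ExchangeStep L t s := by
  obtain ⟨hs, ht, p, q, hpq, hsum, hoff⟩ := h
  exact ⟨ht, hs, p, q, hpq, hsum.symm, fun c hp hq => (hoff c hp hq).symm⟩

theorem ExchangeStep.sum_eq {n k : ℕ} {L : Set (Fin n → ℤ)} {s t : Fin k → Fin n → ℤ}
    (h : ExchangeStep L s t) : ∑ c, s c = ∑ c, t c := by
  obtain ⟨-, -, p, q, hpq, hsum, hoff⟩ := h
  exact (sum_eq_sum_iff_of_eq_off_pair hpq hoff).2 hsum

theorem reflTransGen_exchangeStep_symm {n k : ℕ} {L : Set (Fin n → ℤ)}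
    {s t : Fin k → Fin n → ℤ} (h : Relation.ReflTransGen (ExchangeStep L) s t) :
    Relation.ReflTransGen (ExchangeStep L) t s := by
  induction h with
  | refl => exact .refl
  | tail _ hst ih => exact .head hst.symm ih

theorem reflTransGen_exchangeStep_sum_eq {n k : ℕ} {L : Set (Fin n → ℤ)}
    {s t : Fin k → Fin n → ℤ} (h : Relation.ReflTransGen (ExchangeStep L) s t) :
    ∑ c, s c = ∑ c, t c := by
  induction h with
  | refl => rfl
  | tail _ hst ih => exact ih.trans hst.sum_eq

/-! ### Stable vectors and signed stable vectors -/

/-- The indicator vectors of the stable sets of `G`, as integer vectors. -/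
def stableVectors {n : ℕ} (G : SimpleGraph (Fin n)) : Set (Fin n → ℤ) :=
  {a | (∀ i, a i = 0 ∨ a i = 1) ∧ ∀ i j, G.Adj i j → a i = 0 ∨ a j = 0}

/-- The vectors with entries in `{-1, 0, 1}` whose support is a stable set of `G`. -/
def signedStableVectors {n : ℕ} (G : SimpleGraph (Fin n)) : Set (Fin n → ℤ) :=
  {a | (∀ i, a i = 0 ∨ a i = 1 ∨ a i = -1) ∧ ∀ i j, G.Adj i j → a i = 0 ∨ a j = 0}

theorem stableVectors_subset_signedStableVectors {n : ℕ} (G : SimpleGraph (Fin n)) :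
    stableVectors G ⊆ signedStableVectors G :=
  fun _ ha => ⟨fun i => (ha.1 i).imp_right Or.inl, ha.2⟩

/-- A vector obtained from a signed stable vector by replacing some entries by zero and changing
the signs of others is again one. -/
theorem signedStableVectors_of_support {n : ℕ} {G : SimpleGraph (Fin n)} {a b : Fin n → ℤ}
    (ha : a ∈ signedStableVectors G) (hb : ∀ i, b i = 0 ∨ b i = 1 ∨ b i = -1)
    (h : ∀ i, a i = 0 → b i = 0) : b ∈ signedStableVectors G :=
  ⟨hb, fun i j hij => (ha.2 i j hij).imp (h i) (h j)⟩

theorem stableVectors_of_support {n : ℕ} {G : SimpleGraph (Fin n)} {a b : Fin n → ℤ}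
    (ha : a ∈ signedStableVectors G) (hb : ∀ i, b i = 0 ∨ b i = 1)
    (h : ∀ i, b i = 1 → a i = 1) : b ∈ stableVectors G := by
  refine ⟨hb, fun i j hij => ?_⟩
  have h1 := hb i
  have h2 := hb j
  have h3 := h i
  have h4 := h j
  have h5 := ha.2 i j hij
  grind

/-! ### From stable vectors to signed stable vectors -/

/-- Replacing a `1` and a `-1` in the same coordinate by two zeros is an exchange move, so every
family of signed stable vectors is joined to one without such cancelling pairs. -/
theorem exists_reflTransGen_without_cancellation {n k : ℕ} {G : SimpleGraph (Fin n)}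
    (s : Fin k → Fin n → ℤ) (hs : ∀ c, s c ∈ signedStableVectors G) :
    ∃ t, (∀ c, t c ∈ signedStableVectors G) ∧
      Relation.ReflTransGen (ExchangeStep (signedStableVectors G)) s t ∧
      ∀ i p q, ¬(t p i = 1 ∧ t q i = -1) := by
  induction hN : ∑ c, ∑ i, (s c i).natAbs using Nat.strong_induction_on generalizing s with
  | _ N ih =>
  by_cases hc : ∀ i p q, ¬(s p i = 1 ∧ s q i = -1)
  · exact ⟨s, hs, .refl, hc⟩
  push Not at hc
  obtain ⟨i, p, q, hp, hq⟩ := hc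
  have hpq : p ≠ q := by rintro rfl; omega
  set t : Fin k → Fin n → ℤ :=
    fun c j => if j = i ∧ (c = p ∨ c = q) then 0 else s c j with ht
  have htmem : ∀ c, t c ∈ signedStableVectors G := fun c => by
    refine signedStableVectors_of_support (hs c) (fun j => ?_) fun j hj => ?_
    · have := (hs c).1 j
      simp only [ht]; split_ifs <;> simp_all
    · simp only [ht]; split_ifs <;> simp_all
  have hlt : ∑ c, ∑ j, (t c j).natAbs < N := by
    rw [← hN]
    have hle : ∀ c j, (t c j).natAbs ≤ (s c j).natAbs := fun c j => by
      simp only [ht]; split_ifs <;> simp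
    refine Finset.sum_lt_sum (fun c _ => Finset.sum_le_sum fun j _ => hle c j)
      ⟨p, Finset.mem_univ _, Finset.sum_lt_sum (fun j _ => hle p j) ⟨i, Finset.mem_univ _, ?_⟩⟩
    simp [ht, hp]
  have hstep : ExchangeStep (signedStableVectors G) s t := by
    refine ⟨hs, htmem, p, q, hpq, ?_, fun c h1 h2 => ?_⟩
    · funext j
      by_cases hj : j = i
      · subst hj; simp [ht, hp, hq]
      · simp [ht, hj]
    · funext j; simp [ht, h1, h2]
  obtain ⟨r, hr, htr, hrc⟩ := ih _ hlt t htmem rfl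
  exact ⟨r, hr, .head hstep htr, hrc⟩

/-- In a family without cancelling pairs the signs are those of the sum. -/
theorem eq_sign_mul_abs_of_without_cancellation {n k : ℕ} {G : SimpleGraph (Fin n)}
    {s : Fin k → Fin n → ℤ} (hs : ∀ c, s c ∈ signedStableVectors G)
    (hc : ∀ i p q, ¬(s p i = 1 ∧ s q i = -1)) (c : Fin k) (i : Fin n) :
    s c i = (if (∑ d, s d) i < 0 then -1 else 1) * |s c i| := by
  rw [Finset.sum_apply]
  rcases (hs c).1 i with h | h | h
  · simp [h]
  · have hnn : 0 ≤ ∑ d, s d i := Finset.sum_nonneg fun d _ => by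
      have := (hs d).1 i
      have := hc i c d
      omega
    rw [if_neg (not_lt.2 hnn), h]; simp
  · have hlt : ∑ d, s d i < ∑ _d : Fin k, (0 : ℤ) := by
      refine Finset.sum_lt_sum (fun d _ => ?_) ⟨c, Finset.mem_univ _, by omega⟩
      have := (hs d).1 i
      have := hc i d c
      omega
    rw [Finset.sum_const_zero] at hlt
    rw [if_pos hlt, h]; simp

/-- If the families of stable vectors with a given sum are connected, so are the families of
signed stable vectors: after removing all cancelling pairs, both families are obtained from families
of stable vectors by the same change of signs. -/
theorem exchangeConnected_signedStableVectors {n : ℕ} {G : SimpleGraph (Fin n)}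
    (h : ExchangeConnected (stableVectors G)) : ExchangeConnected (signedStableVectors G) := by
  intro k s t hs ht hst
  obtain ⟨s', hs', hss', hsc⟩ := exists_reflTransGen_without_cancellation s hs
  obtain ⟨t', ht', htt', htc⟩ := exists_reflTransGen_without_cancellation t ht
  have hsum : ∑ c, s' c = ∑ c, t' c := by
    rw [← reflTransGen_exchangeStep_sum_eq hss', hst, reflTransGen_exchangeStep_sum_eq htt']
  set ε : Fin n → ℤ := fun i => if (∑ d, s' d) i < 0 then -1 else 1 with hε
  have hεε : ∀ i, ε i * ε i = 1 := fun i => by simp only [hε]; split_ifs <;> simp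
  have hs1 : ∀ c i, s' c i = ε i * |s' c i| := eq_sign_mul_abs_of_without_cancellation hs' hsc
  have ht1 : ∀ c i, t' c i = ε i * |t' c i| := by
    simp only [hε, hsum]
    exact eq_sign_mul_abs_of_without_cancellation ht' htc
  have habs : ∀ a : Fin n → ℤ, a ∈ signedStableVectors G →
      |a| ∈ stableVectors G := fun a ha => by
    refine ⟨fun i => ?_, fun i j hij => ?_⟩
    · rcases ha.1 i with h | h | h <;> simp [h]
    · simpa using ha.2 i j hij
  have habsum : ∀ r : Fin k → Fin n → ℤ, (∀ c i, r c i = ε i * |r c i|) →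
      ∑ c, |r c| = ε * ∑ c, r c := fun r hr => by
    funext i
    rw [Finset.sum_apply, Pi.mul_apply, Finset.sum_apply, Finset.mul_sum]
    refine Finset.sum_congr rfl fun c _ => ?_
    conv_rhs => rw [hr c i, ← mul_assoc, hεε, one_mul]
    rfl
  have hpath := h k (fun c => |s' c|) (fun c => |t' c|) (fun c => habs _ (hs' c))
    (fun c => habs _ (ht' c)) (by rw [habsum s' hs1, habsum t' ht1, hsum])
  have hlift := Relation.ReflTransGen.lift
    (p := ExchangeStep (signedStableVectors G))
    (f := fun (r : Fin k → Fin n → ℤ) c => ε * r c) (fun a b hab => ?_) _ _ hpath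
  · have e1 : (fun c => ε * |s' c|) = s' := by funext c i; exact (hs1 c i).symm
    have e2 : (fun c => ε * |t' c|) = t' := by funext c i; exact (ht1 c i).symm
    simp only [Function.onFun, e1, e2] at hlift
    exact (hss'.trans hlift).trans (reflTransGen_exchangeStep_symm htt')
  · have hmem : ∀ r ∈ stableVectors G, ε * r ∈ signedStableVectors G := fun r hr => by
      refine signedStableVectors_of_support (stableVectors_subset_signedStableVectors G hr)
        (fun i => ?_) fun i hi => by simp [hi]
      rcases hr.1 i with h0 | h0 <;> simp only [Pi.mul_apply, h0, hε] <;> split_ifs <;> simp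
    obtain ⟨ha, hb, p, q, hpq, hsum', hoff⟩ := hab
    exact ⟨fun c => hmem _ (ha c), fun c => hmem _ (hb c), p, q, hpq,
      by simp only [← mul_add, hsum'], fun c h1 h2 => by simp only [hoff c h1 h2]⟩

/-! ### From signed stable vectors to stable vectors -/

/-- A family of vectors with entries `0` and `1` which is `1` only where the family `s` is `1`. -/
def Dominated {n k : ℕ} (t s : Fin k → Fin n → ℤ) : Prop :=
  ∀ c i, t c i = 0 ∨ t c i = 1 ∧ s c i = 1

theorem Dominated.mem_stableVectors {n k : ℕ} {G : SimpleGraph (Fin n)}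
    {t s : Fin k → Fin n → ℤ} (h : Dominated t s) (hs : ∀ c, s c ∈ signedStableVectors G)
    (c : Fin k) : t c ∈ stableVectors G :=
  stableVectors_of_support (hs c) (fun i => (h c i).imp_right And.left)
    fun i hi => by have := h c i; omega

/-- Every nonnegative sum of a family with entries at most `1` is attained by a dominated family. -/
theorem exists_dominated_sum_eq {n k : ℕ} (s : Fin k → Fin n → ℤ) (hs : ∀ c i, s c i ≤ 1)
    (h0 : ∀ i, 0 ≤ (∑ c, s c) i) : ∃ t, Dominated t s ∧ ∑ c, t c = ∑ c, s c := by
  have hex : ∀ i, ∃ A : Finset (Fin k), A ⊆ Finset.univ.filter (fun c => s c i = 1) ∧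
      A.card = ((∑ c, s c) i).toNat := fun i => by
    refine Finset.exists_subset_card_eq ?_
    have : (∑ c, s c) i ≤ ((Finset.univ.filter fun c => s c i = 1).card : ℤ) := by
      rw [Finset.sum_apply, Finset.card_filter, Nat.cast_sum]
      refine Finset.sum_le_sum fun c _ => ?_
      have := hs c i
      split_ifs <;> simp <;> omega
    omega
  choose A hA hcard using hex
  refine ⟨fun c i => if c ∈ A i then 1 else 0, fun c i => ?_, ?_⟩
  · by_cases hc : c ∈ A i
    · exact Or.inr ⟨by simp [hc], (Finset.mem_filter.1 (hA i hc)).2⟩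
    · exact Or.inl (by simp [hc])
  · funext i
    rw [Finset.sum_apply, Finset.sum_ite_mem, Finset.univ_inter, Finset.sum_const, hcard i]
    have := h0 i
    simp only [nsmul_eq_mul, mul_one]
    omega

/-- Two families dominated by the same family of signed stable vectors, with the same sum, are
joined by moving single entries `1` from one vector to another. -/
theorem Dominated.reflTransGen_exchangeStep {n k : ℕ} {G : SimpleGraph (Fin n)}
    {s t t' : Fin k → Fin n → ℤ} (hs : ∀ c, s c ∈ signedStableVectors G)
    (ht : Dominated t s) (ht' : Dominated t' s) (hsum : ∑ c, t c = ∑ c, t' c) :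
    Relation.ReflTransGen (ExchangeStep (stableVectors G)) t t' := by
  induction hN : ∑ c, ∑ i, (t c i - t' c i).natAbs using Nat.strong_induction_on
    generalizing t with
  | _ N ih =>
  by_cases heq : t = t'
  · subst heq; exact .refl
  have hne : ∃ c i, t c i ≠ t' c i := by
    by_contra! hcon
    exact heq (funext fun c => funext fun i => hcon c i)
  obtain ⟨c₀, i, hc₀⟩ := hne
  have hsi : ∑ c, t c i = ∑ c, t' c i := by
    simpa [Finset.sum_apply] using congrFun hsum i
  have hlt : ∃ p, t' p i < t p i := by
    by_contra! hcon
    exact (Finset.sum_lt_sum (fun c _ => hcon c)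
      ⟨c₀, Finset.mem_univ _, lt_of_le_of_ne (hcon c₀) hc₀⟩).ne hsi
  have hgt : ∃ q, t q i < t' q i := by
    by_contra! hcon
    exact (Finset.sum_lt_sum (fun c _ => hcon c)
      ⟨c₀, Finset.mem_univ _, lt_of_le_of_ne (hcon c₀) hc₀.symm⟩).ne hsi.symm
  obtain ⟨p, hp⟩ := hlt
  obtain ⟨q, hq⟩ := hgt
  have hpq : p ≠ q := by rintro rfl; omega
  have htp := ht p i
  have htp' := ht' p i
  have htq := ht q i
  have htq' := ht' q i
  set r : Fin k → Fin n → ℤ :=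
    fun c j => if j = i then (if c = p then 0 else if c = q then 1 else t c j) else t c j with hr
  have hrd : Dominated r s := fun c j => by
    have := ht c j
    grind
  have hstep : ExchangeStep (stableVectors G) t r := by
    refine ⟨ht.mem_stableVectors hs, hrd.mem_stableVectors hs, p, q, hpq, ?_, fun c h1 h2 => ?_⟩
    · funext j
      by_cases hj : j = i
      · subst hj; simp [hr, hpq.symm]; omega
      · simp [hr, hj]
    · funext j; simp [hr, h1, h2]
  have hle : ∀ c j, (r c j - t' c j).natAbs ≤ (t c j - t' c j).natAbs := fun c j => by
    grind
  refine .head hstep (ih _ ?_ hrd (hstep.sum_eq.symm.trans hsum) rfl)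
  rw [← hN]
  refine Finset.sum_lt_sum (fun c _ => Finset.sum_le_sum fun j _ => hle c j)
    ⟨p, Finset.mem_univ _, Finset.sum_lt_sum (fun j _ => hle p j) ⟨i, Finset.mem_univ _, ?_⟩⟩
  simp only [hr, if_true]
  omega

/-- An exchange move between families of signed stable vectors is followed by an exchange move
between suitable dominated families with the same sum. -/
theorem ExchangeStep.exists_dominated {n k : ℕ} {G : SimpleGraph (Fin n)}
    {s s' : Fin k → Fin n → ℤ} (h : ExchangeStep (signedStableVectors G) s s')
    (h0 : ∀ i, 0 ≤ (∑ c, s c) i) :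
    ∃ t t', Dominated t s ∧ Dominated t' s' ∧ ∑ c, t c = ∑ c, s c ∧
      ExchangeStep (stableVectors G) t t' := by
  obtain ⟨hs, hs', p, q, hpq, hsum, hoff⟩ := h
  have hsumi : ∀ i, s p i + s q i = s' p i + s' q i := fun i => congrFun hsum i
  -- A cancelling pair at `p` and `q` may be absent from `s'`, so `t` must avoid such pairs: they are
  -- zeroed first. In every other coordinate the entries `1` of `s'` at `p` and `q` are those of `s`,
  -- possibly transposed, and `t'` follows that transposition.
  set r : Fin k → Fin n → ℤ :=
    fun c i => if (c = p ∨ c = q) ∧ s p i + s q i = 0 then 0 else s c i with hr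
  have hrsum : ∑ c, r c = ∑ c, s c := by
    refine (sum_eq_sum_iff_of_eq_off_pair hpq fun c h1 h2 => ?_).2 ?_
    · funext i; simp [hr, h1, h2]
    · funext i
      simp only [hr, Pi.add_apply]
      split_ifs <;> simp_all
  obtain ⟨t, htr, htsum⟩ := exists_dominated_sum_eq r (fun c i => by
    have := (hs c).1 i
    simp only [hr]; split_ifs <;> omega) (by rwa [hrsum])
  have hts : Dominated t s := fun c i => by
    have h1 := htr c i
    simp only [hr] at h1
    split_ifs at h1 <;> omega
  set t' : Fin k → Fin n → ℤ := fun c i =>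
    if (c = p ∨ c = q) ∧ s p i ≠ s' p i then t (Equiv.swap p q c) i else t c i with ht'
  have htp' : ∀ i, t' p i = if s p i = s' p i then t p i else t q i := fun i => by
    simp only [ht']; split_ifs <;> simp_all
  have htq' : ∀ i, t' q i = if s p i = s' p i then t q i else t p i := fun i => by
    simp only [ht']; split_ifs <;> simp_all
  have hoff' : ∀ c, c ≠ p → c ≠ q → t c = t' c := fun c h1 h2 => by
    funext i; simp [ht', h1, h2]
  have hts' : Dominated t' s' := fun c i => by
    by_cases h1 : c = p ∨ c = q
    · have e1 := htr p i
      have e2 := htr q i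
      have e3 := (hs p).1 i
      have e4 := (hs q).1 i
      have e5 := (hs' p).1 i
      have e6 := (hs' q).1 i
      have e7 := hsumi i
      simp only [hr, true_or, or_true, true_and] at e1 e2
      rcases h1 with rfl | rfl
      · rw [htp']; split_ifs at * <;> omega
      · rw [htq']; split_ifs at * <;> omega
    · push Not at h1
      rw [← hoff' c h1.1 h1.2, ← hoff c h1.1 h1.2]
      exact hts c i
  refine ⟨t, t', hts, hts', htsum.trans hrsum, hts.mem_stableVectors hs,
    hts'.mem_stableVectors hs', p, q, hpq, ?_, hoff'⟩
  funext i
  simp only [Pi.add_apply, htp', htq']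
  split_ifs <;> omega

/-- If the families of signed stable vectors with a given sum are connected, so are the families of
stable vectors: along a path of signed families one carries dominated unsigned families. -/
theorem exchangeConnected_stableVectors_of_signed {n : ℕ} {G : SimpleGraph (Fin n)}
    (h : ExchangeConnected (signedStableVectors G)) : ExchangeConnected (stableVectors G) := by
  intro k s t hs ht hst
  have hself : ∀ r : Fin k → Fin n → ℤ, (∀ c, r c ∈ stableVectors G) → Dominated r r :=
    fun r hr c i => ((hr c).1 i).imp_right fun h => ⟨h, h⟩
  have h0 : ∀ i, 0 ≤ (∑ c, s c) i := fun i => by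
    rw [Finset.sum_apply]
    exact Finset.sum_nonneg fun c _ => by have := (hs c).1 i; omega
  have hsS := fun c => stableVectors_subset_signedStableVectors G (hs c)
  have hpath := h k s t hsS (fun c => stableVectors_subset_signedStableVectors G (ht c)) hst
  suffices H : ∀ r, Relation.ReflTransGen (ExchangeStep (signedStableVectors G)) s r →
      ∀ u, Dominated u r → ∑ c, u c = ∑ c, s c →
        Relation.ReflTransGen (ExchangeStep (stableVectors G)) s u from
    H t hpath t (hself t ht) hst.symm
  intro r hr
  induction hr with
  | refl => exact fun u hu hsum =>
      (hself s hs).reflTransGen_exchangeStep hsS hu hsum.symm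
  | @tail r r' hsr hrr' ih =>
    intro u hu hsum
    have hsum_r := reflTransGen_exchangeStep_sum_eq hsr
    obtain ⟨v, v', hv, hv', hvsum, hvv'⟩ := hrr'.exists_dominated (by rwa [← hsum_r])
    refine ((ih v hv (hvsum.trans hsum_r.symm)).tail hvv').trans ?_
    refine hv'.reflTransGen_exchangeStep hrr'.2.1 hu ?_
    rw [← hvv'.sum_eq, hvsum, hsum, hsum_r]

/-! ### Binomial ideals generated by quadratic binomials -/

/-- A quadratic move between two monomials, given by their exponents: a factor of degree two is
replaced by another one with the same image under `E`. -/
def QuadraticStep {σ M : Type*} [AddCommMonoid M] (E : (σ →₀ ℕ) →+ M) (u v : σ →₀ ℕ) : Prop :=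
  ∃ w p q : σ →₀ ℕ, p.degree = 2 ∧ q.degree = 2 ∧ E p = E q ∧ u = w + p ∧ v = w + q

section

variable {σ M : Type*} [AddCommMonoid M] {E : (σ →₀ ℕ) →+ M}

theorem QuadraticStep.symm {u v : σ →₀ ℕ} (h : QuadraticStep E u v) : QuadraticStep E v u := by
  obtain ⟨w, p, q, hp, hq, hpq, hu, hv⟩ := h
  exact ⟨w, q, p, hq, hp, hpq.symm, hv, hu⟩

theorem QuadraticStep.add_right {u v : σ →₀ ℕ} (h : QuadraticStep E u v) (r : σ →₀ ℕ) :
    QuadraticStep E (u + r) (v + r) := by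
  obtain ⟨w, p, q, hp, hq, hpq, rfl, rfl⟩ := h
  exact ⟨w + r, p, q, hp, hq, hpq, add_right_comm _ _ _, add_right_comm _ _ _⟩

theorem reflTransGen_quadraticStep_symm {u v : σ →₀ ℕ}
    (h : Relation.ReflTransGen (QuadraticStep E) u v) :
    Relation.ReflTransGen (QuadraticStep E) v u := by
  induction h with
  | refl => exact .refl
  | tail _ hst ih => exact .head hst.symm ih

theorem reflTransGen_quadraticStep_add_right {u v : σ →₀ ℕ}
    (h : Relation.ReflTransGen (QuadraticStep E) u v) (r : σ →₀ ℕ) :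
    Relation.ReflTransGen (QuadraticStep E) (u + r) (v + r) :=
  h.lift (· + r) fun _ _ hab => hab.add_right r

/-- The congruence on exponents generated by the quadratic moves. -/
def quadraticCon (E : (σ →₀ ℕ) →+ M) : AddCon (σ →₀ ℕ) where
  r := Relation.ReflTransGen (QuadraticStep E)
  iseqv := ⟨fun _ => .refl, reflTransGen_quadraticStep_symm, fun h h' => h.trans h'⟩
  add' {w x y z} h h' := by
    refine (reflTransGen_quadraticStep_add_right h y).trans ?_
    rw [add_comm x y, add_comm x z]
    exact reflTransGen_quadraticStep_add_right h' x

variable (K : Type*) [Field K]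

theorem mapDomainRingHom_monomial {N : Type*} [AddCommMonoid N] (F : (σ →₀ ℕ) →+ N) (u : σ →₀ ℕ)
    (c : K) : AddMonoidAlgebra.mapDomainRingHom K F (MvPolynomial.monomial u c) =
      AddMonoidAlgebra.single (F u) c :=
  AddMonoidAlgebra.mapDomain_single

theorem binomial_mem_ker_iff {N : Type*} [AddCommMonoid N] (F : (σ →₀ ℕ) →+ N) (u v : σ →₀ ℕ) :
    MvPolynomial.monomial u 1 - MvPolynomial.monomial v 1 ∈
      RingHom.ker (AddMonoidAlgebra.mapDomainRingHom K F) ↔ F u = F v := by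
  rw [RingHom.mem_ker, map_sub, mapDomainRingHom_monomial, mapDomainRingHom_monomial, sub_eq_zero]
  exact (AddMonoidAlgebra.single_left_injective one_ne_zero).eq_iff

/-- An ideal containing all binomials `x^u - x^v` with `E u = E v` contains the kernel of the
homomorphism `x^u ↦ t^(E u)`: modulo the ideal, the class of a monomial depends only on its
image, so reduction modulo the ideal factors through that homomorphism. -/
theorem ker_mapDomainRingHom_le {I : Ideal (MvPolynomial σ K)}
    (hI : ∀ u v, E u = E v → MvPolynomial.monomial u 1 - MvPolynomial.monomial v 1 ∈ I) :
    RingHom.ker (AddMonoidAlgebra.mapDomainRingHom K E) ≤ I := by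
  let ρ : M → MvPolynomial σ K ⧸ I := fun m =>
    Ideal.Quotient.mk I (MvPolynomial.monomial (Function.invFun E m) 1)
  let ψ : AddMonoidAlgebra K M →ₗ[K] MvPolynomial σ K ⧸ I :=
    Finsupp.linearCombination K ρ ∘ₗ (AddMonoidAlgebra.coeffLinearEquiv K).toLinearMap
  have hψ : ∀ p, ψ (AddMonoidAlgebra.mapDomainRingHom K E p) = Ideal.Quotient.mk I p := by
    intro p
    induction p using MvPolynomial.induction_on' with
    | add p q hp hq => rw [map_add, map_add, map_add, hp, hq]
    | monomial u c =>
      have h1 : ψ (AddMonoidAlgebra.single (E u) c) = c • ρ (E u) :=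
        Finsupp.linearCombination_single K c (E u)
      have h2 : ρ (E u) = Ideal.Quotient.mk I (MvPolynomial.monomial u 1) :=
        Ideal.Quotient.eq.2 (hI _ _ (Function.invFun_eq ⟨u, rfl⟩))
      rw [mapDomainRingHom_monomial, h1, h2, ← Ideal.Quotient.mkₐ_eq_mk K, ← map_smul,
        MvPolynomial.smul_monomial, smul_eq_mul, mul_one]
  intro p hp
  rw [← Ideal.Quotient.eq_zero_iff_mem, ← hψ, RingHom.mem_ker.1 hp, map_zero]

/-- The kernel of `x^u ↦ t^(E u)` is generated by quadratic binomials if and only if any two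
monomials with the same image are joined by quadratic moves. For the forward direction, the
homomorphism to the algebra of the quotient by `quadraticCon` kills the generators. -/
theorem generatedByQuadraticBinomials_ker_iff (E : (σ →₀ ℕ) →+ M) :
    GeneratedByQuadraticBinomials (RingHom.ker (AddMonoidAlgebra.mapDomainRingHom K E)) ↔
      ∀ u v, E u = E v → Relation.ReflTransGen (QuadraticStep E) u v := by
  constructor
  · rintro ⟨F, hF, hspan⟩ u v huv
    have hle : RingHom.ker (AddMonoidAlgebra.mapDomainRingHom K E) ≤
        RingHom.ker (AddMonoidAlgebra.mapDomainRingHom K (quadraticCon E).mk') := by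
      rw [← hspan, Ideal.span_le]
      intro b hb
      have hbE : b ∈ RingHom.ker (AddMonoidAlgebra.mapDomainRingHom K E) :=
        hspan ▸ Ideal.subset_span hb
      obtain ⟨p, q, hp, hq, -, rfl⟩ := hF b hb
      rw [binomial_mem_ker_iff] at hbE
      refine (binomial_mem_ker_iff K _ p q).2 ((AddCon.eq _).2 (Relation.ReflTransGen.single ?_))
      exact ⟨0, p, q, hp, hq, hbE, (zero_add p).symm, (zero_add q).symm⟩
    have h := hle ((binomial_mem_ker_iff K E u v).2 huv)
    rw [binomial_mem_ker_iff] at h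
    exact (AddCon.eq _).1 h
  · intro h
    refine ⟨{b | IsQuadraticBinomial b ∧ b ∈ RingHom.ker (AddMonoidAlgebra.mapDomainRingHom K E)},
      fun b hb => hb.1, le_antisymm (Ideal.span_le.2 fun b hb => hb.2)
        (ker_mapDomainRingHom_le K fun u v huv => ?_)⟩
    have huv' := h u v huv
    clear huv h
    induction huv' with
    | refl => rw [sub_self]; exact zero_mem _
    | @tail v v' _ hst ih =>
      obtain ⟨w, p, q, hp, hq, hpq, rfl, rfl⟩ := hst
      rw [← sub_add_sub_cancel _ (MvPolynomial.monomial (w + p) 1)]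
      refine add_mem ih ?_
      by_cases hne : p = q
      · rw [hne, sub_self]; exact zero_mem _
      · have e : ∀ r : σ →₀ ℕ, MvPolynomial.monomial (w + r) (1 : K) =
            MvPolynomial.monomial w 1 * MvPolynomial.monomial r 1 := fun r => by
          rw [MvPolynomial.monomial_mul, one_mul]
        rw [e, e, ← mul_sub]
        exact Ideal.mul_mem_left _ _ (Ideal.subset_span
          ⟨⟨p, q, hp, hq, hne, rfl⟩, (binomial_mem_ker_iff K E p q).2 hpq⟩)

end

/-! ### Toric ideals and families of lattice vectors -/

/-- The exponent of the image of a monomial under the toric map: `x_a` has the exponent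
`(a, 1)`. -/
noncomputable def toricExponent {n : ℕ} (L : Set (Fin n → ℤ)) :
    (L →₀ ℕ) →+ (Fin n → ℤ) × ℕ :=
  Finsupp.liftAddHom fun a => multiplesHom _ (a.1, 1)

theorem toricIdeal_eq_ker_mapDomainRingHom (K : Type*) [Field K] {n : ℕ}
    (P : Set (Fin n → ℝ)) : toricIdeal K P =
      RingHom.ker (AddMonoidAlgebra.mapDomainRingHom K (toricExponent (latticePoints P))) := by
  have hmap : ∀ p, (toricMap K P p : LaurentRing K n) =
      AddMonoidAlgebra.mapDomainRingHom K (toricExponent (latticePoints P)) p := by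
    intro p
    induction p using MvPolynomial.induction_on with
    | C c =>
      rw [← MvPolynomial.algebraMap_eq, AlgHom.commutes, MvPolynomial.algebraMap_eq,
        MvPolynomial.C_apply, mapDomainRingHom_monomial, map_zero]
      rfl
    | add p q hp hq => rw [map_add, map_add, Subalgebra.coe_add, hp, hq]
    | mul_X p a hp =>
      rw [map_mul, map_mul, Subalgebra.coe_mul, hp, MvPolynomial.X, mapDomainRingHom_monomial]
      congr 1
      rw [← MvPolynomial.X, toricMap, MvPolynomial.aeval_X]
      simp [toricMonomial, toricExponent]
  ext p
  rw [toricIdeal, RingHom.mem_ker, RingHom.mem_ker, ← hmap, ZeroMemClass.coe_eq_zero]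

section

variable {n k : ℕ} {L : Set (Fin n → ℤ)}

/-- The exponent of the monomial which is the product of the variables of a family. -/
noncomputable def familyExponent (s : Fin k → L) : L →₀ ℕ := ∑ c, Finsupp.single (s c) 1

theorem toricExponent_single (a : L) : toricExponent L (Finsupp.single a 1) = (a.1, 1) := by
  simp [toricExponent]

theorem toricExponent_familyExponent (s : Fin k → L) :
    toricExponent L (familyExponent s) = (∑ c, (s c).1, k) := by
  rw [familyExponent, map_sum]
  simp only [toricExponent_single]
  ext <;> simp [Prod.fst_sum, Prod.snd_sum]

theorem exists_familyExponent_eq (u : L →₀ ℕ) : ∃ k, ∃ s : Fin k → L, familyExponent s = u := by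
  induction u using Finsupp.induction_linear with
  | zero => exact ⟨0, Fin.elim0, by simp [familyExponent]⟩
  | add u v hu hv =>
    obtain ⟨k, s, rfl⟩ := hu
    obtain ⟨l, t, rfl⟩ := hv
    exact ⟨k + l, Fin.append s t, by simp [familyExponent, Fin.sum_univ_add]⟩
  | single a m => exact ⟨m, fun _ => a, by simp [familyExponent]⟩

theorem exists_eq_single_add_single {σ : Type*} {p : σ →₀ ℕ} (hp : p.degree = 2) :
    ∃ x y, p = Finsupp.single x 1 + Finsupp.single y 1 := by
  classical
  have hcard : (Finsupp.toMultiset p).card = 2 := by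
    rw [Finsupp.card_toMultiset, ← hp]
    rfl
  obtain ⟨x, y, hxy⟩ := Multiset.card_eq_two.1 hcard
  refine ⟨x, y, (AddEquiv.injective Multiset.toFinsupp.symm) ?_⟩
  change Finsupp.toMultiset p = Finsupp.toMultiset _
  rw [hxy, map_add, Finsupp.toMultiset_single, Finsupp.toMultiset_single]
  rfl

/-- Families with the same monomial differ by a permutation, and a transposition is an exchange
move. -/
theorem reflTransGen_exchangeStep_of_familyExponent_eq (s t : Fin k → L)
    (h : familyExponent s = familyExponent t) :
    Relation.ReflTransGen (ExchangeStep L) (fun c => (s c).1) (fun c => (t c).1) := by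
  classical
  induction hN : {c | s c ≠ t c}.ncard using Nat.strong_induction_on generalizing s with
  | _ N ih =>
  by_cases heq : ∀ c, s c = t c
  · rw [show s = t from funext heq]
  push Not at heq
  obtain ⟨p, hp⟩ := heq
  have hcount : ∀ (r : Fin k → L) (x : L),
      familyExponent r x = (Finset.univ.filter fun c => r c = x).card := fun r x => by
    rw [familyExponent, Finsupp.finsetSum_apply, Finset.card_filter]
    exact Finset.sum_congr rfl fun c _ => Finsupp.single_apply
  obtain ⟨q, hq, hq'⟩ : ∃ q, s q = t p ∧ t q ≠ t p := by
    by_contra! hcon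
    have hsub : (Finset.univ.filter fun c => s c = t p) ⊆ Finset.univ.filter fun c => t c = t p :=
      fun c hc => by simpa using hcon c (by simpa using hc)
    have hset := Finset.eq_of_subset_of_card_le hsub (by rw [← hcount, ← hcount, h])
    have hpmem : p ∈ Finset.univ.filter fun c => s c = t p := by rw [hset]; simp
    exact hp (by simpa using hpmem)
  have hpq : p ≠ q := by rintro rfl; exact hq' rfl
  set r : Fin k → L := fun c => s (Equiv.swap p q c) with hr
  have hrp : r p = t p := by simp only [hr, Equiv.swap_apply_left, hq]
  have hrq : r q = s p := by simp only [hr, Equiv.swap_apply_right]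
  have hrc : ∀ c, c ≠ p → c ≠ q → r c = s c := fun c h1 h2 => by
    simp only [hr, Equiv.swap_apply_of_ne_of_ne h1 h2]
  have hrt : familyExponent r = familyExponent t := by
    rw [← h]
    exact Equiv.sum_comp (Equiv.swap p q) fun c => Finsupp.single (s c) 1
  refine .head (b := fun c => (r c).1) ⟨fun c => (s c).2, fun c => (r c).2, p, q, hpq, ?_,
    fun c h1 h2 => congrArg Subtype.val (hrc c h1 h2).symm⟩ (ih _ ?_ r hrt rfl)
  · simp only [hrp, hrq, hq, add_comm]
  · rw [← hN]
    refine Set.ncard_lt_ncard ⟨fun c hc => ?_, fun hsub => ?_⟩ (Set.toFinite _)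
    · by_cases h1 : c = p
      · rw [h1]; exact hp
      by_cases h2 : c = q
      · rw [h2, Set.mem_ofPred_eq, hq]; exact hq'.symm
      · rw [Set.mem_ofPred_eq, ← hrc c h1 h2]; exact hc
    · exact hsub (show p ∈ {c | s c ≠ t c} from hp) hrp

/-- A quadratic move on the monomial of a family comes from an exchange move. -/
theorem QuadraticStep.exists_exchangeStep {s : Fin k → L} {v : L →₀ ℕ}
    (h : QuadraticStep (toricExponent L) (familyExponent s) v) :
    ∃ t : Fin k → L, familyExponent t = v ∧
      ExchangeStep L (fun c => (s c).1) (fun c => (t c).1) := by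
  classical
  obtain ⟨w, a, b, ha, hb, hab, hs, rfl⟩ := h
  obtain ⟨x, y, rfl⟩ := exists_eq_single_add_single ha
  obtain ⟨x', y', rfl⟩ := exists_eq_single_add_single hb
  have hsum : x.1 + y.1 = x'.1 + y'.1 := by
    have h1 := congrArg Prod.fst hab
    simpa only [map_add, toricExponent_single, Prod.fst_add] using h1
  have hmem : ∀ (A : Finset (Fin k)) (z : L), (∑ c ∈ A, Finsupp.single (s c) 1) z ≠ 0 →
      ∃ c ∈ A, s c = z := fun A z hz => by
    rw [Finsupp.finsetSum_apply] at hz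
    obtain ⟨c, hcA, hc⟩ := Finset.exists_ne_zero_of_sum_ne_zero hz
    exact ⟨c, hcA, by by_contra hne; exact hc (Finsupp.single_eq_of_ne (Ne.symm hne))⟩
  obtain ⟨p, -, hp⟩ := hmem Finset.univ x (by
    change familyExponent s x ≠ 0
    rw [hs]; simp)
  have hs' : ∑ c ∈ Finset.univ.erase p, Finsupp.single (s c) 1 = w + Finsupp.single y 1 := by
    rw [familyExponent, ← Finset.add_sum_erase _ _ (Finset.mem_univ p), hp,
      add_left_comm w] at hs
    exact add_left_cancel hs
  obtain ⟨q, hqA, hq⟩ := hmem (Finset.univ.erase p) y (by rw [hs']; simp)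
  have hpq : p ≠ q := (Finset.mem_erase.1 hqA).1.symm
  have hw : ∑ c ∈ (Finset.univ.erase p).erase q, Finsupp.single (s c) 1 = w := by
    rw [← Finset.add_sum_erase _ _ hqA, hq, add_comm w] at hs'
    exact add_left_cancel hs'
  set t : Fin k → L := fun c => if c = p then x' else if c = q then y' else s c with ht
  have htp : t p = x' := if_pos rfl
  have htq : t q = y' := by rw [ht]; simp [hpq.symm]
  have htc : ∀ c, c ≠ p → c ≠ q → t c = s c := fun c h1 h2 => by simp [ht, h1, h2]
  refine ⟨t, ?_, fun c => (s c).2, fun c => (t c).2, p, q, hpq, ?_, fun c h1 h2 => ?_⟩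
  · rw [familyExponent, sum_eq_add_add_sum_erase _ hpq, htp, htq, ← hw, add_comm]
    congr 1
    refine Finset.sum_congr rfl fun c hc => ?_
    rw [htc c (Finset.mem_erase.1 (Finset.mem_erase.1 hc).2).1 (Finset.mem_erase.1 hc).1]
  · simp only [hp, hq, htp, htq, hsum]
  · simp only [htc c h1 h2]

/-- An exchange move between families is a quadratic move between their monomials. -/
theorem quadraticStep_of_exchangeStep {s t : Fin k → L}
    (h : ExchangeStep L (fun c => (s c).1) (fun c => (t c).1)) :
    QuadraticStep (toricExponent L) (familyExponent s) (familyExponent t) := by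
  obtain ⟨-, -, p, q, hpq, hsum, hoff⟩ := h
  refine ⟨∑ c ∈ (Finset.univ.erase p).erase q, Finsupp.single (s c) 1,
    Finsupp.single (s p) 1 + Finsupp.single (s q) 1,
    Finsupp.single (t p) 1 + Finsupp.single (t q) 1, by simp, by simp, ?_, ?_, ?_⟩
  · simp only [map_add, toricExponent_single, Prod.mk_add_mk, hsum]
  · rw [familyExponent, sum_eq_add_add_sum_erase _ hpq, add_comm]
  · rw [familyExponent, sum_eq_add_add_sum_erase _ hpq, add_comm]
    congr 1
    refine Finset.sum_congr rfl fun c hc => ?_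
    rw [Subtype.ext (hoff c (Finset.mem_erase.1 (Finset.mem_erase.1 hc).2).1
      (Finset.mem_erase.1 hc).1)]

theorem reflTransGen_quadraticStep_of_exchangeStep {s t : Fin k → L}
    (h : Relation.ReflTransGen (ExchangeStep L) (fun c => (s c).1) (fun c => (t c).1)) :
    Relation.ReflTransGen (QuadraticStep (toricExponent L)) (familyExponent s)
      (familyExponent t) := by
  suffices H : ∀ r, Relation.ReflTransGen (ExchangeStep L) (fun c => (s c).1) r →
      ∀ u : Fin k → L, (fun c => (u c).1) = r →
        Relation.ReflTransGen (QuadraticStep (toricExponent L)) (familyExponent s)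
          (familyExponent u) from H _ h t rfl
  intro r hr
  induction hr with
  | refl =>
    intro u hu
    rw [show u = s from funext fun c => Subtype.ext (congrFun hu c)]
  | @tail r r' hsr hrr' ih =>
    rintro u rfl
    exact (ih (fun c => ⟨r c, hrr'.1 c⟩) rfl).tail (quadraticStep_of_exchangeStep hrr')

end

/-- The toric ideal is generated by quadratic binomials if and only if the families of lattice
points with a given sum are connected under exchange moves. -/
theorem generatedByQuadraticBinomials_toricIdeal_iff (K : Type*) [Field K] {n : ℕ}
    (P : Set (Fin n → ℝ)) :
    GeneratedByQuadraticBinomials (toricIdeal K P) ↔ ExchangeConnected (latticePoints P) := by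
  rw [toricIdeal_eq_ker_mapDomainRingHom, generatedByQuadraticBinomials_ker_iff]
  constructor
  · intro h k s t hs ht hst
    let s' : Fin k → latticePoints P := fun c => ⟨s c, hs c⟩
    let t' : Fin k → latticePoints P := fun c => ⟨t c, ht c⟩
    have hpath := h (familyExponent s') (familyExponent t') (by
      rw [toricExponent_familyExponent, toricExponent_familyExponent]
      exact Prod.ext hst rfl)
    suffices H : ∀ v, Relation.ReflTransGen (QuadraticStep (toricExponent (latticePoints P)))
        (familyExponent s') v → ∃ r : Fin k → latticePoints P, familyExponent r = v ∧
          Relation.ReflTransGen (ExchangeStep (latticePoints P)) s fun c => (r c).1 by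
      obtain ⟨r, hr, hsr⟩ := H _ hpath
      exact hsr.trans (reflTransGen_exchangeStep_of_familyExponent_eq r t' hr)
    intro v hv
    induction hv with
    | refl => exact ⟨s', rfl, .refl⟩
    | tail _ hst ih =>
      obtain ⟨r, rfl, hsr⟩ := ih
      obtain ⟨r', rfl, hrr'⟩ := hst.exists_exchangeStep
      exact ⟨r', rfl, hsr.tail hrr'⟩
  · intro h u v huv
    obtain ⟨k, s, rfl⟩ := exists_familyExponent_eq u
    obtain ⟨l, t, rfl⟩ := exists_familyExponent_eq v
    rw [toricExponent_familyExponent, toricExponent_familyExponent] at huv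
    obtain rfl : k = l := congrArg Prod.snd huv
    exact reflTransGen_quadraticStep_of_exchangeStep
      (h k _ _ (fun c => (s c).2) (fun c => (t c).2) (congrArg Prod.fst huv))

/-! ### Kempe equivalence of colorings -/

/-- Two colorings of a finite graph which differ only on vertices having one of the colors `i` and
`j` in both of them are Kempe equivalent: on each component of the subgraph spanned by these two
colors they either agree or are exchanged. -/
theorem kempeEquivalent_of_two_colors {V : Type*} [Finite V] {H : SimpleGraph V} {k : ℕ}
    (f g : H.Coloring (Fin k)) {i j : Fin k} (hij : i ≠ j)
    (h : ∀ v, f v = g v ∨ (f v = i ∨ f v = j) ∧ (g v = i ∨ g v = j)) : KempeEquivalent f g := by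
  classical
  wlog hlt : i < j generalizing i j
  · exact this hij.symm (fun v => (h v).imp_right fun h => ⟨h.1.symm, h.2.symm⟩)
      (lt_of_le_of_ne (not_lt.1 hlt) hij.symm)
  induction hN : {v | f v ≠ g v}.ncard using Nat.strong_induction_on generalizing f with
  | _ N ih =>
  by_cases heq : ∀ v, f v = g v
  · rw [show f = g from DFunLike.ext _ _ heq]; exact .refl
  push Not at heq
  obtain ⟨v, hv⟩ := heq
  have hvij : f v = i ∨ f v = j := ((h v).resolve_left hv).1
  set C := (H.induce {v | f v = i ∨ f v = j}).connectedComponentMk ⟨v, hvij⟩ with hC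
  have hmem : ∀ x, x ∈ Subtype.val '' C.supp → (f x = i ∨ f x = j) := by
    rintro _ ⟨x, -, rfl⟩; exact x.2
  have hclosed : ∀ x y, H.Adj x y → x ∈ Subtype.val '' C.supp → (f y = i ∨ f y = j) →
      y ∈ Subtype.val '' C.supp := by
    rintro _ y hxy ⟨x, hx, rfl⟩ hy
    refine ⟨⟨y, hy⟩, ?_, rfl⟩
    have hadj : (H.induce {v | f v = i ∨ f v = j}).Adj x ⟨y, hy⟩ := hxy
    rw [SimpleGraph.ConnectedComponent.mem_supp_iff] at hx ⊢
    rw [← hx]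
    exact SimpleGraph.ConnectedComponent.sound hadj.symm.reachable
  -- Along an edge between the two colors a disagreement of `f` and `g` propagates.
  have hwalk : ∀ x y : {v | f v = i ∨ f v = j},
      (H.induce {v | f v = i ∨ f v = j}).Walk x y → f x ≠ g x → f y ≠ g y := by
    intro x y w
    induction w with
    | nil => exact id
    | @cons x y z hxy w ihw =>
      intro hx
      refine ihw ?_
      have h1 := f.valid (v := x) (w := y) hxy
      have h2 := g.valid (v := x) (w := y) hxy
      have h3 := h x
      have h4 := h y
      have h5 : f x = i ∨ f x = j := x.2
      have h6 : f y = i ∨ f y = j := y.2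
      grind
  have hdis : ∀ x, x ∈ Subtype.val '' C.supp → f x ≠ g x := by
    rintro _ ⟨x, hx, rfl⟩
    rw [SimpleGraph.ConnectedComponent.mem_supp_iff, hC] at hx
    obtain ⟨w⟩ := SimpleGraph.ConnectedComponent.exact hx
    exact hwalk _ _ w.reverse hv
  let f' : H.Coloring (Fin k) := SimpleGraph.Coloring.mk
    (fun x => if x ∈ Subtype.val '' C.supp then Equiv.swap i j (f x) else f x) (by
      intro x y hxy
      have h1 := f.valid hxy
      have hx := hmem x
      have hy := hmem y
      have hxy' := hclosed x y hxy
      have hyx' := hclosed y x hxy.symm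
      have hinj := (Equiv.swap i j).injective.ne h1
      split_ifs with h2 h3 h3
      · exact hinj
      · intro h4
        rcases hx h2 with h5 | h5 <;> simp only [h5, Equiv.swap_apply_left,
          Equiv.swap_apply_right] at h4 <;> exact h3 (hxy' h2 (by simp [← h4]))
      · intro h4
        rcases hy h3 with h5 | h5 <;> simp only [h5, Equiv.swap_apply_left,
          Equiv.swap_apply_right] at h4 <;> exact h2 (hyx' h3 (by simp [h4]))
      · exact h1)
  have hf' : ∀ x, f' x = if x ∈ Subtype.val '' C.supp then Equiv.swap i j (f x) else f x :=
    fun x => rfl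
  have hf'g : ∀ x, x ∈ Subtype.val '' C.supp → f' x = g x := by
    intro x hx
    have h1 := hdis x hx
    have h2 := h x
    rw [hf', if_pos hx]
    rcases hmem x hx with h3 | h3
    · rw [h3, Equiv.swap_apply_left]; grind
    · rw [h3, Equiv.swap_apply_right]; grind
  have hf'f : ∀ x, x ∉ Subtype.val '' C.supp → f' x = f x := fun x hx => by rw [hf', if_neg hx]
  have hstep : KempeSwitch f f' := by
    refine ⟨i, j, hlt, C, hf'f, fun x hx hxj => ?_, fun x hx hxi => ?_⟩
    · rw [hf', if_pos hx, hxj, Equiv.swap_apply_right]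
    · rw [hf', if_pos hx, hxi, Equiv.swap_apply_left]
  refine .head hstep (ih _ ?_ f' (fun x => ?_) rfl)
  · rw [← hN]
    refine Set.ncard_lt_ncard ⟨fun x hx => ?_, fun hsub => ?_⟩ (Set.toFinite _)
    · by_contra hfx
      by_cases hxC : x ∈ Subtype.val '' C.supp
      · exact hx (hf'g x hxC)
      · exact hx ((hf'f x hxC).trans (not_not.1 hfx))
    · exact hsub (show v ∈ {v | f v ≠ g v} from hv)
        (hf'g v ⟨⟨v, hvij⟩, SimpleGraph.ConnectedComponent.mem_supp_iff _ _ |>.2 hC.symm, rfl⟩)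
  · by_cases hxC : x ∈ Subtype.val '' C.supp
    · exact Or.inl (hf'g x hxC)
    · rw [hf'f x hxC]; exact h x

/-! ### Colorings of replication graphs as families of stable vectors -/

open Classical in
/-- The family of the color classes of a coloring of `G_a`, each projected to `G` and written as an
indicator vector. -/
noncomputable def colorVectors {n k : ℕ} {G : SimpleGraph (Fin n)} {a : Fin n → ℕ}
    (f : (replicationGraph G a).Coloring (Fin k)) : Fin k → Fin n → ℤ :=
  fun c i => if ∃ x, f ⟨i, x⟩ = c then 1 else 0

section

variable {n k : ℕ} {G : SimpleGraph (Fin n)} {a : Fin n → ℕ}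

theorem colorVectors_eq_one_iff {f : (replicationGraph G a).Coloring (Fin k)} {c : Fin k}
    {i : Fin n} : colorVectors f c i = 1 ↔ ∃ x, f ⟨i, x⟩ = c := by
  unfold colorVectors; split_ifs <;> simp_all

theorem colorVectors_eq_zero_or_one (f : (replicationGraph G a).Coloring (Fin k)) (c : Fin k)
    (i : Fin n) : colorVectors f c i = 0 ∨ colorVectors f c i = 1 := by
  unfold colorVectors; split_ifs <;> simp

theorem coloring_injective_on_clique (f : (replicationGraph G a).Coloring (Fin k)) (i : Fin n) :
    Function.Injective fun x : Fin (a i) => f ⟨i, x⟩ := by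
  intro x y hxy
  by_contra hne
  exact f.valid (show (replicationGraph G a).Adj ⟨i, x⟩ ⟨i, y⟩ from
    Or.inl ⟨rfl, fun h => hne (by simpa using h)⟩) hxy

theorem colorVectors_mem (f : (replicationGraph G a).Coloring (Fin k)) (c : Fin k) :
    colorVectors f c ∈ stableVectors G := by
  refine ⟨colorVectors_eq_zero_or_one f c, fun i j hij => ?_⟩
  by_contra! hcon
  obtain ⟨x, hx⟩ := colorVectors_eq_one_iff.1
    ((colorVectors_eq_zero_or_one f c i).resolve_left hcon.1)
  obtain ⟨y, hy⟩ := colorVectors_eq_one_iff.1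
    ((colorVectors_eq_zero_or_one f c j).resolve_left hcon.2)
  exact f.valid (show (replicationGraph G a).Adj ⟨i, x⟩ ⟨j, y⟩ from Or.inr hij) (hx.trans hy.symm)

theorem sum_colorVectors (f : (replicationGraph G a).Coloring (Fin k)) :
    ∑ c, colorVectors f c = fun i => (a i : ℤ) := by
  classical
  funext i
  rw [Finset.sum_apply]
  have : (Finset.univ.image fun x : Fin (a i) => f ⟨i, x⟩).card = a i := by
    rw [Finset.card_image_of_injective _ (coloring_injective_on_clique f i), Finset.card_fin]
  rw [← this, Finset.card_eq_sum_ones, Nat.cast_sum, ← Finset.sum_subset (Finset.subset_univ _)]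
  · refine Finset.sum_congr rfl fun c hc => ?_
    obtain ⟨x, -, hx⟩ := Finset.mem_image.1 hc
    exact colorVectors_eq_one_iff.2 ⟨x, hx⟩
  · intro c _ hc
    refine (colorVectors_eq_zero_or_one f c i).resolve_right fun h => hc ?_
    obtain ⟨x, hx⟩ := colorVectors_eq_one_iff.1 h
    exact Finset.mem_image.2 ⟨x, Finset.mem_univ _, hx⟩

/-- A family of vectors with sum `a` is the family of color classes of `f` as soon as each vertex
`(i, x)` gets a color whose vector contains `i`. -/
theorem colorVectors_eq_of_forall {f : (replicationGraph G a).Coloring (Fin k)}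
    {s : Fin k → Fin n → ℤ} (hs : ∀ c, s c ∈ stableVectors G)
    (hsum : ∑ c, s c = fun i => (a i : ℤ)) (h : ∀ i x, s (f ⟨i, x⟩) i = 1) :
    colorVectors f = s := by
  have hle : ∀ c i, colorVectors f c i ≤ s c i := fun c i => by
    rcases colorVectors_eq_zero_or_one f c i with h0 | h1
    · have := (hs c).1 i; omega
    · obtain ⟨x, rfl⟩ := colorVectors_eq_one_iff.1 h1
      rw [h1, h]
  have hsum' : ∀ i, ∑ c, colorVectors f c i = ∑ c, s c i := fun i => by
    rw [← Finset.sum_apply, ← Finset.sum_apply, sum_colorVectors, hsum]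
  funext c i
  exact (Finset.sum_eq_sum_iff_of_le fun c _ => hle c i).1 (hsum' i) c (Finset.mem_univ c)

theorem exists_colorVectors_eq {s : Fin k → Fin n → ℤ} (hs : ∀ c, s c ∈ stableVectors G)
    (hsum : ∑ c, s c = fun i => (a i : ℤ)) :
    ∃ f : (replicationGraph G a).Coloring (Fin k), colorVectors f = s := by
  have hcard : ∀ i, Fintype.card {c // s c i = 1} = a i := fun i => by
    have h1 : (Fintype.card {c // s c i = 1} : ℤ) = ∑ c, s c i := by
      rw [Fintype.card_subtype, Finset.card_filter, Nat.cast_sum]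
      refine Finset.sum_congr rfl fun c _ => ?_
      rcases (hs c).1 i with h | h <;> simp [h]
    rw [← Finset.sum_apply, hsum] at h1
    dsimp only at h1
    exact_mod_cast h1
  let e : ∀ i, Fin (a i) ≃ {c // s c i = 1} := fun i =>
    (Fintype.equivFinOfCardEq (hcard i)).symm
  let f : (replicationGraph G a).Coloring (Fin k) :=
    SimpleGraph.Coloring.mk (fun v => (e v.1 v.2).1) (by
      rintro ⟨i, x⟩ ⟨j, y⟩ (⟨hij, hne⟩ | hij) heq
      · obtain rfl : i = j := hij
        exact hne (congrArg (Sigma.mk i) ((e i).injective (Subtype.ext heq)))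
      · have h1 := (e i x).2
        have h2 := (e j y).2
        have h3 := (hs (e i x).1).2 i j hij
        simp only at heq
        rw [← heq] at h2
        omega)
  exact ⟨f, colorVectors_eq_of_forall hs hsum fun i x => (e i x).2⟩

/-- Colorings of `G_a` with the same color classes in `G` differ by permutations of the cliques
replacing the vertices, and exchanging two vertices of a clique is realized by Kempe switchings. -/
theorem kempeEquivalent_of_colorVectors_eq (f g : (replicationGraph G a).Coloring (Fin k))
    (h : colorVectors f = colorVectors g) : KempeEquivalent f g := by
  induction hN : {v | f v ≠ g v}.ncard using Nat.strong_induction_on generalizing f with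
  | _ N ih =>
  by_cases heq : ∀ v, f v = g v
  · rw [show f = g from DFunLike.ext _ _ heq]; exact .refl
  push Not at heq
  obtain ⟨⟨i, x⟩, hv⟩ := heq
  obtain ⟨y, hy⟩ : ∃ y, f ⟨i, y⟩ = g ⟨i, x⟩ := by
    rw [← colorVectors_eq_one_iff, h, colorVectors_eq_one_iff]
    exact ⟨x, rfl⟩
  have hxy : (⟨i, x⟩ : Σ i, Fin (a i)) ≠ ⟨i, y⟩ := by
    intro hxy; rw [← hxy] at hy; exact hv hy
  set τ : Equiv.Perm (Σ i, Fin (a i)) := Equiv.swap ⟨i, x⟩ ⟨i, y⟩ with hτ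
  have hτ1 : ∀ v, (τ v).1 = v.1 := fun v => by
    by_cases h1 : v = ⟨i, x⟩
    · rw [h1, hτ, Equiv.swap_apply_left]
    by_cases h2 : v = ⟨i, y⟩
    · rw [h2, hτ, Equiv.swap_apply_right]
    rw [hτ, Equiv.swap_apply_of_ne_of_ne h1 h2]
  let f' : (replicationGraph G a).Coloring (Fin k) := SimpleGraph.Coloring.mk (fun v => f (τ v)) (by
    intro v w hvw
    refine f.valid ?_
    rcases hvw with ⟨h1, h2⟩ | h1
    · exact Or.inl ⟨by rw [hτ1, hτ1, h1], τ.injective.ne h2⟩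
    · exact Or.inr (by rwa [hτ1, hτ1]))
  have hf' : ∀ v, f' v = f (τ v) := fun v => rfl
  have hx' : f' ⟨i, x⟩ = g ⟨i, x⟩ := by rw [hf', hτ, Equiv.swap_apply_left, hy]
  have hy' : f' ⟨i, y⟩ = f ⟨i, x⟩ := by rw [hf', hτ, Equiv.swap_apply_right]
  have hrest : ∀ v, v ≠ ⟨i, x⟩ → v ≠ ⟨i, y⟩ → f' v = f v := fun v h1 h2 => by
    rw [hf', hτ, Equiv.swap_apply_of_ne_of_ne h1 h2]
  have hff' : KempeEquivalent f f' := by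
    refine kempeEquivalent_of_two_colors f f' (i := f ⟨i, x⟩) (j := f ⟨i, y⟩)
      (by rw [hy]; exact hv) fun v => ?_
    by_cases h1 : v = ⟨i, x⟩
    · subst h1; right; simp [hx', hy]
    by_cases h2 : v = ⟨i, y⟩
    · subst h2; right; simp [hy']
    exact Or.inl (hrest v h1 h2).symm
  have hcv : colorVectors f' = colorVectors f :=
    colorVectors_eq_of_forall (colorVectors_mem f) (sum_colorVectors f) fun j z => by
      have h1 : colorVectors f (f (τ ⟨j, z⟩)) (τ ⟨j, z⟩).1 = 1 :=
        colorVectors_eq_one_iff.2 ⟨(τ ⟨j, z⟩).2, rfl⟩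
      rwa [hτ1] at h1
  refine hff'.trans (ih _ ?_ f' (hcv.trans h) rfl)
  rw [← hN]
  have hgy : f ⟨i, y⟩ ≠ g ⟨i, y⟩ := by
    rw [hy]
    intro hxy'
    exact hxy (by rw [coloring_injective_on_clique g i hxy'])
  refine Set.ncard_lt_ncard ⟨fun v hvg => ?_, fun hsub => ?_⟩ (Set.toFinite _)
  · by_cases h1 : v = ⟨i, x⟩
    · subst h1; exact hv
    by_cases h2 : v = ⟨i, y⟩
    · subst h2; exact hgy
    · simpa [hrest v h1 h2] using hvg
  · exact hsub (show (⟨i, x⟩ : Σ i, Fin (a i)) ∈ {v | f v ≠ g v} from hv) hx'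

/-- An exchange move on the family of color classes is realized by Kempe switchings. -/
theorem ExchangeStep.exists_kempeEquivalent {f : (replicationGraph G a).Coloring (Fin k)}
    {s : Fin k → Fin n → ℤ} (h : ExchangeStep (stableVectors G) (colorVectors f) s) :
    ∃ g, KempeEquivalent f g ∧ colorVectors g = s := by
  have hsum : ∑ c, s c = fun i => (a i : ℤ) := h.sum_eq.symm.trans (sum_colorVectors f)
  obtain ⟨-, hs, p, q, hpq, hpair, hoff⟩ := h
  have hpair' : ∀ i, colorVectors f p i + colorVectors f q i = s p i + s q i :=
    fun i => congrFun hpair i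
  -- A vertex keeps its color if the new vector of that color still contains it, and otherwise
  -- moves to the other one of the two colors.
  let φ : (Σ i, Fin (a i)) → Fin k := fun v =>
    if s (f v) v.1 = 1 then f v else Equiv.swap p q (f v)
  have hone : ∀ v, colorVectors f (f v) v.1 = 1 := fun v => colorVectors_eq_one_iff.2 ⟨v.2, rfl⟩
  have hmove : ∀ v, s (f v) v.1 ≠ 1 → f v = p ∧ s q v.1 = 1 ∧ φ v = q ∧ s p v.1 = 0 ∨
      f v = q ∧ s p v.1 = 1 ∧ φ v = p ∧ s q v.1 = 0 := by
    intro v hv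
    have h1 := hone v
    have h2 := hpair' v.1
    have h3 := (hs p).1 v.1
    have h4 := (hs q).1 v.1
    have h5 := colorVectors_eq_zero_or_one f p v.1
    have h6 := colorVectors_eq_zero_or_one f q v.1
    have hφ : φ v = Equiv.swap p q (f v) := if_neg hv
    by_cases hp : f v = p
    · rw [hp] at h1 hv
      refine Or.inl ⟨hp, ?_, by rw [hφ, hp, Equiv.swap_apply_left], ?_⟩ <;> omega
    by_cases hq : f v = q
    · rw [hq] at h1 hv
      refine Or.inr ⟨hq, ?_, by rw [hφ, hq, Equiv.swap_apply_right], ?_⟩ <;> omega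
    · exact absurd (by rw [← hoff _ hp hq]; exact h1) hv
  have hstay : ∀ v, s (f v) v.1 = 1 → φ v = f v := fun v hv => if_pos hv
  have hφs : ∀ v, s (φ v) v.1 = 1 := by
    intro v
    by_cases hv : s (f v) v.1 = 1
    · rw [hstay v hv]; exact hv
    · rcases hmove v hv with ⟨-, h1, h2, -⟩ | ⟨-, h1, h2, -⟩ <;> rw [h2] <;> exact h1
  let g : (replicationGraph G a).Coloring (Fin k) := SimpleGraph.Coloring.mk φ (by
    intro v w hvw heq
    have hne := f.valid hvw
    rcases hvw with ⟨h1, -⟩ | h1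
    · have hv1 := hone v
      have hw1 := hone w
      have h2 := hpair' v.1
      rw [← h1] at hw1
      have h5 := hmove v
      have h6 := hmove w
      have h7 := hstay v
      have h8 := hstay w
      rw [← h1] at h6 h8
      have h9 := (hs p).1 v.1
      have h10 := (hs q).1 v.1
      grind
    · have h3 := hφs v
      have h4 := hφs w
      have h5 := (hs (φ v)).2 _ _ h1
      rw [← heq] at h4
      omega)
  refine ⟨g, kempeEquivalent_of_two_colors f g hpq fun v => ?_,
    colorVectors_eq_of_forall hs hsum fun i x => hφs ⟨i, x⟩⟩
  change f v = φ v ∨ _ ∧ (φ v = p ∨ φ v = q)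
  by_cases hv : s (f v) v.1 = 1
  · exact Or.inl (hstay v hv).symm
  · have := hmove v hv
    tauto

/-- A Kempe switching changes only two of the color classes, so it is an exchange move. -/
theorem KempeSwitch.exchangeStep {f g : (replicationGraph G a).Coloring (Fin k)}
    (h : KempeSwitch f g) : ExchangeStep (stableVectors G) (colorVectors f) (colorVectors g) := by
  obtain ⟨i, j, hij, H, h1, h2, h3⟩ := h
  have hH : ∀ x, x ∈ Subtype.val '' H.supp → (f x = i ∨ f x = j) := by
    rintro _ ⟨x, -, rfl⟩; exact x.2
  have hoff : ∀ c, c ≠ i → c ≠ j → colorVectors f c = colorVectors g c := fun c hci hcj => by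
    have hiff : ∀ v, f v = c ↔ g v = c := fun v => by
      have e1 := h1 v
      have e2 := h2 v
      have e3 := h3 v
      have e4 := hH v
      grind
    funext l
    simp only [colorVectors, hiff]
  exact ⟨colorVectors_mem f, colorVectors_mem g, i, j, hij.ne,
    (sum_eq_sum_iff_of_eq_off_pair hij.ne hoff).1
      ((sum_colorVectors f).trans (sum_colorVectors g).symm), hoff⟩

end

/-- Kempe equivalence of all colorings of all replication graphs is the connectedness of families of
stable vectors under exchange moves. -/
theorem exchangeConnected_stableVectors_iff_kempe {n : ℕ} (G : SimpleGraph (Fin n)) :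
    ExchangeConnected (stableVectors G) ↔ ∀ (a : Fin n → ℕ) (k : ℕ),
      (replicationGraph G a).chromaticNumber ≤ (k : ℕ∞) →
        ∀ f g : (replicationGraph G a).Coloring (Fin k), KempeEquivalent f g := by
  constructor
  · intro h a k _ f g
    have hpath := h k (colorVectors f) (colorVectors g) (colorVectors_mem f) (colorVectors_mem g)
      ((sum_colorVectors f).trans (sum_colorVectors g).symm)
    suffices H : ∀ s, Relation.ReflTransGen (ExchangeStep (stableVectors G)) (colorVectors f) s →
        ∃ f', KempeEquivalent f f' ∧ colorVectors f' = s by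
      obtain ⟨f', hff', hf'⟩ := H _ hpath
      exact hff'.trans (kempeEquivalent_of_colorVectors_eq f' g hf')
    intro s hs
    induction hs with
    | refl => exact ⟨f, .refl, rfl⟩
    | tail _ hst ih =>
      obtain ⟨f', hff', rfl⟩ := ih
      obtain ⟨f'', hf'', rfl⟩ := hst.exists_kempeEquivalent
      exact ⟨f'', hff'.trans hf'', rfl⟩
  · intro h k s t hs ht hst
    have h0 : ∀ i, 0 ≤ (∑ c, s c) i := fun i => by
      rw [Finset.sum_apply]
      exact Finset.sum_nonneg fun c _ => by have := (hs c).1 i; omega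
    have hsum : ∑ c, s c = fun i => (((∑ c, s c) i).toNat : ℤ) := by
      funext i; exact (Int.toNat_of_nonneg (h0 i)).symm
    obtain ⟨f, hf⟩ := exists_colorVectors_eq hs hsum
    obtain ⟨g, hg⟩ := exists_colorVectors_eq ht (hst.symm.trans hsum)
    have hfg := h _ k (SimpleGraph.chromaticNumber_le_iff_colorable.2 ⟨f⟩) f g
    rw [← hf, ← hg]
    exact hfg.lift colorVectors fun _ _ => KempeSwitch.exchangeStep

/-! ### Lattice points of the stable set polytopes -/

theorem stableSetPolytope_nonneg {n : ℕ} {G : SimpleGraph (Fin n)} {x : Fin n → ℝ}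
    (hx : x ∈ stableSetPolytope G) (i : Fin n) : 0 ≤ x i := by
  have hbox : stableSetPolytope G ⊆ {x | ∀ i, 0 ≤ x i} := by
    refine convexHull_min ?_ fun x hx y hy b c hb hc _ i => ?_
    · rintro _ ⟨S, -, rfl⟩ i
      exact Set.indicator_nonneg (fun _ _ => zero_le_one) i
    · have := hx i; have := hy i
      simp only [Pi.add_apply, Pi.smul_apply, smul_eq_mul]
      positivity
  exact hbox hx i

theorem latticePoints_stableSetPolytope {n : ℕ} (G : SimpleGraph (Fin n)) :
    latticePoints (stableSetPolytope G) = stableVectors G := by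
  ext a
  constructor
  · intro ha
    have hone : stableSetPolytope G ⊆ {x | ∀ i, x i ≤ 1} := by
      refine convexHull_min ?_ fun x hx y hy b c hb hc hbc i => ?_
      · rintro _ ⟨S, -, rfl⟩ i
        exact Set.indicator_le' (fun _ _ => le_rfl) (fun _ _ => zero_le_one) i
      · simp only [Pi.add_apply, Pi.smul_apply, smul_eq_mul]
        nlinarith [hx i, hy i]
    have hedge : stableSetPolytope G ⊆ {x | ∀ i j, G.Adj i j → x i + x j ≤ 1} := by
      refine convexHull_min ?_ fun x hx y hy b c hb hc hbc i j hij => ?_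
      · rintro _ ⟨S, hS, rfl⟩ i j hij
        by_cases hi : i ∈ S
        · have hj : j ∉ S := fun hj => hS hi hj hij.ne hij
          simp [hi, hj]
        · rw [Set.indicator_of_notMem hi, zero_add]
          exact Set.indicator_le' (fun _ _ => le_rfl) (fun _ _ => zero_le_one) j
      · simp only [Pi.add_apply, Pi.smul_apply, smul_eq_mul]
        nlinarith [hx i j hij, hy i j hij]
    have h0 : ∀ i, 0 ≤ a i := fun i => by
      exact_mod_cast stableSetPolytope_nonneg ha i
    have h1 : ∀ i, a i ≤ 1 := fun i => by exact_mod_cast hone ha i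
    have h2 : ∀ i j, G.Adj i j → a i + a j ≤ 1 := fun i j hij => by
      exact_mod_cast hedge ha i j hij
    refine ⟨fun i => ?_, fun i j hij => ?_⟩
    · have := h0 i; have := h1 i; omega
    · have := h0 i; have := h0 j; have := h2 i j hij; omega
  · rintro ⟨h01, hadj⟩
    refine subset_convexHull ℝ _ ⟨{i | a i = 1}, fun i hi j hj _ hij => ?_, ?_⟩
    · have hi' : a i = 1 := hi
      have hj' : a j = 1 := hj
      have := hadj i j hij
      omega
    · funext i
      rcases h01 i with h | h <;> simp [h]

theorem latticePoints_symmetrize_stableSetPolytope {n : ℕ} (G : SimpleGraph (Fin n)) :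
    latticePoints (symmetrize (stableSetPolytope G)) = signedStableVectors G := by
  ext a
  constructor
  · rintro ⟨ε, hε, x, hx, hax⟩
    -- Up to sign the coordinates of `x` are those of `a`, so `x` is the lattice point `|a|`.
    have habs : |a| ∈ stableVectors G := by
      rw [← latticePoints_stableSetPolytope]
      have hx0 := stableSetPolytope_nonneg hx
      have : (fun i => ((|a| i : ℤ) : ℝ)) = x := by
        funext i
        have h1 : (a i : ℝ) = ε i * x i := congrFun hax i
        rw [Pi.abs_apply, Int.cast_abs, h1, abs_mul, abs_of_nonneg (hx0 i)]
        rcases hε i with h | h <;> simp [h]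
      rw [latticePoints, Set.mem_ofPred_eq, this]
      exact hx
    refine ⟨fun i => ?_, fun i j hij => ?_⟩
    · have h1 := habs.1 i
      rw [Pi.abs_apply, abs_eq_zero, abs_eq zero_le_one] at h1
      exact h1
    · simpa using habs.2 i j hij
  · intro ha
    have habs : |a| ∈ stableVectors G := by
      refine ⟨fun i => ?_, fun i j hij => ?_⟩
      · rcases ha.1 i with h | h | h <;> simp [h]
      · simpa using ha.2 i j hij
    rw [← latticePoints_stableSetPolytope] at habs
    refine ⟨fun i => if a i = -1 then -1 else 1, fun i => ?_, _, habs, ?_⟩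
    · by_cases h : a i = -1 <;> simp [h]
    · funext i
      rcases ha.1 i with h | h | h <;> simp [h]

end StableToric

theorem mainTheorem5 {K : Type*} [Field K] (n : ℕ) (G : SimpleGraph (Fin n)) :
    List.TFAE
      [StableToric.GeneratedByQuadraticBinomials (StableToric.symmetricStableSetIdeal K G),
        StableToric.GeneratedByQuadraticBinomials (StableToric.stableSetIdeal K G),
        ∀ (a : Fin n → ℕ) (k : ℕ),
          (StableToric.replicationGraph G a).chromaticNumber ≤ (k : ℕ∞) →
            ∀ f g : (StableToric.replicationGraph G a).Coloring (Fin k),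
              StableToric.KempeEquivalent f g] := by
  rw [StableToric.symmetricStableSetIdeal, StableToric.stableSetIdeal,
    StableToric.generatedByQuadraticBinomials_toricIdeal_iff,
    StableToric.generatedByQuadraticBinomials_toricIdeal_iff,
    StableToric.latticePoints_stableSetPolytope,
    StableToric.latticePoints_symmetrize_stableSetPolytope,
    ← StableToric.exchangeConnected_stableVectors_iff_kempe]
  tfae_have 1 → 2 := StableToric.exchangeConnected_stableVectors_of_signed
  tfae_have 2 → 1 := StableToric.exchangeConnected_signedStableVectors
  tfae_have 2 ↔ 3 := Iff.rfl
  tfae_finish
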